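/- Let $n\ge 2$, let $k\ge 1$ be an integer, and let $F$ be a probability distribution on $[0,1]$. There are $n$ Bernoulli arms whose means are i.i.d. with law $F$; given the means, all observations of all arms are independent, and each observation of an arm with mean $p$ is a success with probability $p$ and a failure otherwise. Let $s_i$ denote the current number of successes of arm $i$. The play-the-winner (PW) algorithm with critical value $k$ proceeds in rounds; at the start all arms are alive. In each round, the arms that are alive and have not yet had a failure in this round are played once each, repeatedly. After each such simultaneous play: if exactly one alive arm $j$ has had no failure in this round and $s_j\ge \max_{i\ne j}s_i+k$, then the algorithm stops and returns $j$. Otherwise, when all alive arms have had a failure in this round, the round ends: every arm $i$ for which $s_i\le s_j-k$ for some $j\neq i$ is eliminated; if only one arm is then alive, the algorithm stops and returns it, and otherwise a new round starts with the arms that are still alive. Let $C$ be the event that the algorithm stops and returns an arm with the largest mean. Call the arm with the largest mean arm $0$ (ties, if any, are broken uniformly at random), and number the other arms $1,\dots,n-1$ uniformly at random, independently of the observations given the means. Suppose that all arms (also the eliminated ones) take part in every round, being played in each round until they fail, and let $S_i(r)$ be the number of successes of arm $i$ in its first $r$ rounds, computed from the same observation sequence of arm $i$ that the algorithm uses. Arm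 $0$ beats arm $i$ if there is an $r$ such that the first $r$ rounds of both arms are complete, $S_0(r)-S_i(r)\ge k$, and $S_0(r')-S_i(r')>-k$ for all $r'<r$. Let $B_i$ be the event that arm $0$ beats arm $i$, let $B=B_1\cap B_2\cap\dots\cap B_{n-1}$, and let $B^*$ be the event that arm $0$ beats the arm with the largest mean among arms $1,\dots,n-1$ (each such arm, if there are ties). Then $$\mathbb P(C)\ \ge\ \mathbb P(B)\ \ge\ \bigl(\mathbb P(B_1)\bigr)^{n-1}\qquad\text{and}\qquad \mathbb P(B)\ \le\ \mathbb P(B^*).$$ -/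

import Mathlib

open MeasureTheory ProbabilityTheory

noncomputable section

namespace PlayTheWinner

/-! ### The Bayesian Bernoulli bandit -/

/-- The law of the sequence of observations of an arm, given that its mean is `p`:
independent Bernoulli variables with success probability `p` (`true` is a success). -/
def rewardMeasure (p : unitInterval) : Measure (ℕ → Bool) :=
  Measure.infinitePi fun _ : ℕ => bernoulliMeasure true false p

instance (p : unitInterval) : IsProbabilityMeasure (rewardMeasure p) := by
  unfold rewardMeasure; infer_instance

theorem measurable_rewardMeasure : Measurable rewardMeasure := by
  refine Measurable.measure_of_isPiSystem_of_isProbabilityMeasure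
    generateFrom_squareCylinders.symm
    (isPiSystem_squareCylinders (fun _ => MeasurableSpace.isPiSystem_measurableSet) (by simp)) ?_
  rintro _ ⟨s, t, ht, rfl⟩
  have ht' : ∀ i, MeasurableSet (t i) := fun i => ht i (Set.mem_univ i)
  simp only [rewardMeasure]
  have key : ∀ p : unitInterval, Measure.infinitePi (fun _ : ℕ => bernoulliMeasure true false p)
      ((s : Set ℕ).pi t) = ∏ i ∈ s, bernoulliMeasure true false p (t i) :=
    fun p => Measure.infinitePi_pi (fun _ : ℕ => bernoulliMeasure true false p) fun i _ => ht' i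
  simp_rw [key]
  refine Finset.measurable_prod _ fun i _ => ?_
  simp only [bernoulliMeasure_def, Measure.coe_add, Measure.coe_nnreal_smul_apply, Pi.add_apply]
  have h1 : Measurable fun p : unitInterval => ((unitInterval.toNNReal p : NNReal) : ENNReal) := by
    refine measurable_coe_nnreal_ennreal.comp (Continuous.measurable ?_)
    exact continuous_induced_rng.2 continuous_subtype_val
  exact (h1.mul_const _).add ((h1.comp unitInterval.continuous_symm.measurable).mul_const _)

/-- `rewardMeasure` as a Markov kernel from means to observation sequences. -/
def rewardKernel : Kernel unitInterval (ℕ → Bool) := ⟨rewardMeasure, measurable_rewardMeasure⟩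

instance : IsMarkovKernel rewardKernel :=
  ⟨fun p => inferInstanceAs (IsProbabilityMeasure (rewardMeasure p))⟩

/-- Means and observations of `n` arms: `(d i).1` is the mean of arm `i`, and `(d i).2 t` is the
outcome of the `(t + 1)`-st play of arm `i`. -/
abbrev Data (n : ℕ) : Type := Fin n → unitInterval × (ℕ → Bool)

/-- The joint law of means and observations: the means are i.i.d. with law `F`, and given the means
all observations are independent, those of an arm with mean `p` being Bernoulli(`p`). -/
def dataMeasure (F : Measure unitInterval) (n : ℕ) : Measure (Data n) :=
  Measure.pi fun _ : Fin n => F ⊗ₘ rewardKernel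

instance (F : Measure unitInterval) [IsProbabilityMeasure F] (n : ℕ) :
    IsProbabilityMeasure (dataMeasure F n) := by
  unfold dataMeasure; infer_instance

/-! ### Renumbering: the best arm is number `0`, the others are numbered at random -/

/-- A finite set of permutations carries the discrete σ-algebra. -/
instance (n : ℕ) : MeasurableSpace (Equiv.Perm (Fin n)) := ⊤

instance (n : ℕ) : DiscreteMeasurableSpace (Equiv.Perm (Fin n)) := ⟨fun _ => trivial⟩

/-- The numberings of the arms (`σ i` is the arm that gets number `i`) in which number `0` is an
arm with the largest mean. -/
def bestFirst {n : ℕ} [NeZero n] (d : Data n) : Set (Equiv.Perm (Fin n)) :=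
  {σ | ∀ i, (d i).1 ≤ (d (σ 0)).1}

theorem bestFirst_nonempty {n : ℕ} [NeZero n] (d : Data n) : (bestFirst d).Nonempty := by
  obtain ⟨b, hb⟩ := Finite.exists_max fun i => (d i).1
  exact ⟨Equiv.swap 0 b, fun i => by simpa using hb i⟩

theorem measurable_uniformOn_bestFirst {n : ℕ} [NeZero n] :
    Measurable fun d : Data n => uniformOn (bestFirst d) := by
  have h : Measurable fun d : Data n => bestFirst d := by
    refine measurable_set_iff.2 fun σ => ?_
    refine measurableSet_setOfPred.1 ?_
    have : {d : Data n | σ ∈ bestFirst d} = ⋂ i, {d | (d i).1 ≤ (d (σ 0)).1} := by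
      ext d; simp [bestFirst]
    rw [this]
    exact MeasurableSet.iInter fun i => measurableSet_le (by fun_prop) (by fun_prop)
  exact (Measurable.of_discrete (f := fun S : Set (Equiv.Perm (Fin n)) => uniformOn S)).comp h

/-- Given means and observations, the numbering is uniform among those giving number `0` to an
arm with the largest mean. If the means are distinct, number `0` is the best arm and the other
arms are numbered `1, …, n - 1` uniformly at random; it does not depend on the observations. -/
def numberingKernel (n : ℕ) [NeZero n] : Kernel (Data n) (Equiv.Perm (Fin n)) :=
  ⟨fun d => uniformOn (bestFirst d), measurable_uniformOn_bestFirst⟩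

instance (n : ℕ) [NeZero n] : IsMarkovKernel (numberingKernel n) :=
  ⟨fun d => isProbabilityMeasure_uniformOn (Set.toFinite _) (bestFirst_nonempty d)⟩

/-- The probability measure `ℙ` for `n` arms and prior `F`: means, observations and numbering. -/
def banditMeasure (F : Measure unitInterval) (n : ℕ) [NeZero n] :
    Measure (Data n × Equiv.Perm (Fin n)) :=
  dataMeasure F n ⊗ₘ numberingKernel n

instance (F : Measure unitInterval) [IsProbabilityMeasure F] (n : ℕ) [NeZero n] :
    IsProbabilityMeasure (banditMeasure F n) := by
  unfold banditMeasure; infer_instance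

/-! ### The play-the-winner algorithm -/

/-- The only element of a one-element set, and `none` for any other set. -/
def sole {ι : Type*} (A : Finset ι) : Option ι :=
  open Classical in if h : ∃ j, A = {j} then some h.choose else none

theorem sole_eq_some_iff {ι : Type*} (A : Finset ι) (j : ι) : sole A = some j ↔ A = {j} := by
  classical
  unfold sole
  split_ifs with h
  · have hc := h.choose_spec
    constructor
    · intro hj
      exact hc.trans (congrArg _ (Option.some.inj hj))
    · intro hA
      exact congrArg some (Finset.singleton_injective (hc.symm.trans hA))
  · refine iff_of_false (by simp) ?_
    exact fun hA => h ⟨j, hA⟩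

/-- The state of the algorithm between two subrounds. -/
structure State (ι : Type*) where
  /-- the arms not yet eliminated -/
  alive : Finset ι
  /-- the alive arms that had no failure yet in the current round -/
  playing : Finset ι
  /-- number of plays of each arm so far -/
  plays : ι → ℕ
  /-- number of successes of each arm so far -/
  succ : ι → ℕ
  /-- the arm returned, once the algorithm has stopped -/
  returned : Option ι

section Algorithm

variable {ι : Type*} [Fintype ι] [DecidableEq ι]

/-- At the start all arms are alive and the first round begins. -/
def init : State ι where
  alive := Finset.univ
  playing := Finset.univ
  plays := fun _ => 0
  succ := fun _ => 0
  returned := none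

/-- One subround of the algorithm with critical value `k`, where `x i t` is the outcome of the
`(t + 1)`-st play of arm `i`. Every arm with no failure yet in the current round is played once;
those that fail drop out of the round.
* If exactly one arm `j` is still without a failure and leads all others by at least `k`
  successes, stop and return `j`.
* Otherwise, if every alive arm has had its failure, the round ends: eliminate each arm that is at
  least `k` successes behind another one; if one arm is left, stop and return it, else start a
  new round with the arms that are left.
* Otherwise the round goes on. -/
def step (k : ℕ) (x : ι → ℕ → Bool) (s : State ι) : State ι :=
  open Classical in
  if s.returned.isSome then s
  else
    let playing' := s.playing.filter fun i => x i (s.plays i) = true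
    let plays' : ι → ℕ := fun i => if i ∈ s.playing then s.plays i + 1 else s.plays i
    let succ' : ι → ℕ := fun i => if i ∈ playing' then s.succ i + 1 else s.succ i
    if ∃ j, playing' = {j} ∧ ∀ i, i ≠ j → succ' i + k ≤ succ' j then
      { alive := s.alive, playing := playing', plays := plays', succ := succ',
        returned := sole playing' }
    else if playing' = ∅ then
      let alive' := s.alive.filter fun i => ¬ ∃ j, j ≠ i ∧ succ' i + k ≤ succ' j
      { alive := alive', playing := alive', plays := plays', succ := succ',
        returned := sole alive' }
    else
      { alive := s.alive, playing := playing', plays := plays', succ := succ',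
        returned := none }

/-- The algorithm stops after finitely many subrounds and returns arm `j`. -/
def Returns (k : ℕ) (x : ι → ℕ → Bool) (j : ι) : Prop :=
  ∃ t : ℕ, ((step k x)^[t] init).returned = some j

end Algorithm

/-! ### The games between the best arm and the others -/

/-- An arm with observations `x` that is played in every round until it fails has `s` successes in
its first `r` rounds: the first `r + s` plays consist of `s` successes and `r` failures, the last
one being a failure (if `r = 0` there are no plays). -/
def RoundScore (x : ℕ → Bool) (r s : ℕ) : Prop :=
  ∃ m : ℕ, Nat.count (fun t => x t = false) m = r ∧ Nat.count (fun t => x t = true) m = s ∧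
    ∀ t, m = t + 1 → x t = false

/-- In the two-arm game with critical value `k`, where both arms are played in each round until they
fail, the arm with observations `x` beats the one with observations `y`: at the end of some round
it is at least `k` successes ahead, and at the end of no earlier round was it at least `k`
successes behind. -/
def Beats (k : ℕ) (x y : ℕ → Bool) : Prop :=
  ∃ r a b : ℕ, RoundScore x r a ∧ RoundScore y r b ∧ b + k ≤ a ∧
    ∀ r' < r, ∀ a' b', RoundScore x r' a' → RoundScore y r' b' → ¬ a' + k ≤ b'

/-- The event `C`: the algorithm makes the correct choice, i.e. it stops and returns an arm with the
largest mean. -/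
def eventC (k n : ℕ) : Set (Data n × Equiv.Perm (Fin n)) :=
  {ω | ∃ j, Returns k (fun i => (ω.1 i).2) j ∧ ∀ i, (ω.1 i).1 ≤ (ω.1 j).1}

/-- The event `B_i`: number `0`, the best arm, beats number `i`. -/
def eventBi (k n : ℕ) [NeZero n] (i : Fin n) : Set (Data n × Equiv.Perm (Fin n)) :=
  {ω | Beats k (ω.1 (ω.2 0)).2 (ω.1 (ω.2 i)).2}

/-- The event `B = B_1 B_2 ⋯ B_{n-1}`. -/
def eventB (k n : ℕ) [NeZero n] : Set (Data n × Equiv.Perm (Fin n)) :=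
  ⋂ (i : Fin n) (_ : i ≠ 0), eventBi k n i

/-- The event `B*`: number `0` beats the best of numbers `1, …, n - 1` (each of the best ones, in
case of ties). -/
def eventBstar (k n : ℕ) [NeZero n] : Set (Data n × Equiv.Perm (Fin n)) :=
  {ω | ∀ i : Fin n, i ≠ 0 → (∀ j : Fin n, j ≠ 0 → (ω.1 (ω.2 j)).1 ≤ (ω.1 (ω.2 i)).1) →
    Beats k (ω.1 (ω.2 0)).2 (ω.1 (ω.2 i)).2}

end PlayTheWinner

end

/-! `P(C) ≥ P(B)` is deterministic apart from a null set (`returns_of_forall_beats`). Let arm `b`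
beat every other arm. An arm still alive has not yet lost its game against `b`, so at the end of the
current round it is less than `k` ahead. An eliminated arm keeps its score, while that of `b` can
only grow. Hence `b` is never eliminated, and no other arm triggers the early stop. The games last
finitely many plays, so the run ends.

For `P(B) ≥ P(B_1)^(n-1)`, let `z` consist of the data of a candidate for arm `0` and a tie-breaking
variable. Given `z`, the other arms are independent. Let `g z` be the probability that another arm
loses the comparison of means with `z`, and `f z` the probability that it also loses the game. With
one constant `c`, `banditMeasure_relEvent` yields `1 = c ∫ g^(n-1)`, `P(B_1) = c ∫ f g^(n-2)` and
`P(B) = c ∫ f^(n-1)`. Hölder's inequality for `c` times the law of `z` concludes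
(`lintegral_mul_pow_pow_le`).

`P(B) ≤ P(B*)` is an inclusion of events. -/

noncomputable section

namespace PlayTheWinner

section RunWithWinner

/-! ### Completed rounds of an arm -/

/-- The `m`-th play is the end of a round, or `m = 0`. -/
def EndsRound (x : ℕ → Bool) (m : ℕ) : Prop := ∀ t, m = t + 1 → x t = false

/-- The play that ends a round is the first one at which its number of failures is reached; this
makes the score after a given number of rounds unique. -/
theorem EndsRound.le_of_count_le {x : ℕ → Bool} {m p : ℕ} (hm : EndsRound x m)
    (h : Nat.count (fun t => x t = false) m ≤ Nat.count (fun t => x t = false) p) : m ≤ p := by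
  by_contra! hlt
  obtain ⟨t, rfl⟩ : ∃ t, m = t + 1 := ⟨m - 1, by omega⟩
  rw [Nat.count_succ, if_pos (hm t rfl)] at h
  have := Nat.count_monotone (fun t => x t = false) (show p ≤ t by omega)
  omega

theorem lt_of_count_lt {x : ℕ → Bool} {b : Bool} {p m : ℕ}
    (h : Nat.count (fun t => x t = b) p < Nat.count (fun t => x t = b) m) : p < m := by
  by_contra! hle
  have := Nat.count_monotone (fun t => x t = b) hle
  omega

theorem exists_endsRound (x : ℕ → Bool) (m : ℕ) {r : ℕ}
    (hr : r ≤ Nat.count (fun t => x t = false) m) :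
    ∃ m', Nat.count (fun t => x t = false) m' = r ∧ EndsRound x m' := by
  induction m with
  | zero => exact ⟨0, by simp_all, fun t ht => by omega⟩
  | succ m ih =>
    by_cases h : r ≤ Nat.count (fun t => x t = false) m
    · exact ih h
    · rw [Nat.count_succ] at hr
      by_cases hx : x m = false
      · rw [if_pos hx] at hr
        refine ⟨m + 1, ?_, fun t ht => by obtain rfl : m = t := by omega
                                          exact hx⟩
        rw [Nat.count_succ, if_pos hx]; omega
      · rw [if_neg hx] at hr; omega

theorem RoundScore.unique {x : ℕ → Bool} {r s s' : ℕ} (h : RoundScore x r s)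
    (h' : RoundScore x r s') : s = s' := by
  obtain ⟨m, h1, h2, h3⟩ := h
  obtain ⟨m', h1', h2', h3'⟩ := h'
  obtain rfl : m = m' := le_antisymm (EndsRound.le_of_count_le h3 (by omega))
    (EndsRound.le_of_count_le h3' (by omega))
  omega

theorem RoundScore.exists_of_le {x : ℕ → Bool} {r s : ℕ} (h : RoundScore x r s) {r' : ℕ}
    (hr : r' ≤ r) : ∃ s', RoundScore x r' s' := by
  obtain ⟨m, h1, -, -⟩ := h
  obtain ⟨m', h1', h2'⟩ := exists_endsRound x m (hr.trans h1.ge)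
  exact ⟨_, m', h1', rfl, h2'⟩

/-- Bounds the running score of an arm still playing by its score at the end of the round. -/
theorem RoundScore.count_le {x : ℕ → Bool} {r s p : ℕ} (h : RoundScore x r s)
    (hp : Nat.count (fun t => x t = false) p < r) : Nat.count (fun t => x t = true) p ≤ s := by
  obtain ⟨m, h1, rfl, -⟩ := h
  exact Nat.count_monotone _ (lt_of_count_lt (h1 ▸ hp)).le

/-- An arm that beats another one is not `k` behind at the end of any round up to the one in which
it wins. -/
theorem exists_of_beats {k : ℕ} (hk : 0 < k) {x y : ℕ → Bool} (h : Beats k x y) :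
    ∃ r a b, RoundScore x r a ∧ RoundScore y r b ∧ b + k ≤ a ∧
      ∀ r' ≤ r, ∀ a' b', RoundScore x r' a' → RoundScore y r' b' → b' < a' + k := by
  obtain ⟨r, a, b, ha, hb, hab, h⟩ := h
  refine ⟨r, a, b, ha, hb, hab, fun r' hr' a' b' ha' hb' => ?_⟩
  rcases hr'.lt_or_eq with hlt | rfl
  · exact not_le.1 (h r' hlt a' b' ha' hb')
  · have := ha.unique ha'
    have := hb.unique hb'
    omega

/-! ### A run in which one arm beats all others -/

variable {ι : Type*} [Fintype ι]

/-- The state of a run during round `r + 1`, when arm `b` beats all others. -/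
structure RunInvariant (k : ℕ) (x : ι → ℕ → Bool) (b : ι) (N r : ℕ) (s : State ι) : Prop where
  returned : s.returned = none
  mem_alive : b ∈ s.alive
  alive_ne : s.alive ≠ {b}
  playing_subset : s.playing ⊆ s.alive
  playing_nonempty : s.playing.Nonempty
  -- The uniform bound forces termination.
  plays_le : ∀ i, s.plays i ≤ N
  count_true : ∀ i ∈ s.alive, Nat.count (fun t => x i t = true) (s.plays i) = s.succ i
  count_playing : ∀ i ∈ s.playing, Nat.count (fun t => x i t = false) (s.plays i) = r
  count_failed : ∀ i ∈ s.alive, i ∉ s.playing →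
    Nat.count (fun t => x i t = false) (s.plays i) = r + 1 ∧ EndsRound (x i) (s.plays i)
  -- Eliminated arms still count in the stopping and elimination rules, so they too must not be `k`
  -- ahead of `b`.
  succ_lt : ∀ i, i ∉ s.alive → s.succ i < s.succ b + k
  not_won : ∀ i ∈ s.alive, i ≠ b → ∀ r' ≤ r, ∀ a c, RoundScore (x b) r' a →
    RoundScore (x i) r' c → a < c + k

theorem RunInvariant.init {k : ℕ} (hk : 0 < k) (x : ι → ℕ → Bool) (b : ι) (N : ℕ)
    [Nontrivial ι] : RunInvariant k x b N 0 (init : State ι) where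
  returned := rfl
  mem_alive := Finset.mem_univ _
  alive_ne h := by
    obtain ⟨i, hi⟩ := exists_ne b
    have : i ∈ (Finset.univ : Finset ι) := Finset.mem_univ i
    rw [show (Finset.univ : Finset ι) = {b} from h, Finset.mem_singleton] at this
    exact hi this
  playing_subset := subset_rfl
  playing_nonempty := Finset.univ_nonempty_iff.2 ⟨b⟩
  plays_le _ := Nat.zero_le _
  count_true _ _ := by simp [PlayTheWinner.init]
  count_playing _ _ := by simp [PlayTheWinner.init]
  count_failed i _ h := absurd (Finset.mem_univ i) h
  succ_lt i h := absurd (Finset.mem_univ i) h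
  not_won i _ _ r' hr a c ha hc := by
    obtain rfl : r' = 0 := by omega
    have h0 : ∀ i, RoundScore (x i) 0 0 := fun i => ⟨0, by simp, by simp, fun t ht => by omega⟩
    have := (h0 b).unique ha
    have := (h0 i).unique hc
    omega

variable [DecidableEq ι]

theorem RunInvariant.step {k : ℕ} {x : ι → ℕ → Bool} {b : ι} {N r : ℕ}
    {s : State ι} (h : RunInvariant k x b N r s)
    {R A C : ι → ℕ} (hA : ∀ i ≠ b, RoundScore (x b) (R i) (A i))
    (hC : ∀ i ≠ b, RoundScore (x i) (R i) (C i)) (hwin : ∀ i ≠ b, C i + k ≤ A i)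
    (hlead : ∀ i ≠ b, ∀ r' ≤ R i, ∀ a c, RoundScore (x b) r' a → RoundScore (x i) r' c → c < a + k)
    (hNb : ∀ i ≠ b, ∀ m, Nat.count (fun t => x b t = false) m < R i → m < N)
    (hNi : ∀ i ≠ b, ∀ m, Nat.count (fun t => x i t = false) m < R i → m < N) :
    (PlayTheWinner.step k x s).returned = some b ∨
      ((∃ r', RunInvariant k x b N r' (PlayTheWinner.step k x s)) ∧
        ∑ i, s.plays i < ∑ i, (PlayTheWinner.step k x s).plays i) := by
  classical
  -- `b` wins its game against `i` in round `R i`; `not_won` rules this out for rounds up to `r`.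
  have hrR : ∀ i ∈ s.alive, i ≠ b → r < R i := by
    intro i hi hib
    by_contra! hle
    have := h.not_won i hi hib (R i) hle _ _ (hA i hib) (hC i hib)
    have := hwin i hib
    omega
  obtain ⟨i₀, hi₀, hi₀b⟩ : ∃ i ∈ s.alive, i ≠ b := by
    by_contra! hall
    exact h.alive_ne (Finset.eq_singleton_iff_unique_mem.2 ⟨h.mem_alive, hall⟩)
  -- An arm about to play has only `r` failures, fewer than in the deciding round of some game it
  -- takes part in. For `b` itself, the living rival `i₀` supplies that game.
  have hltN : ∀ i ∈ s.playing, s.plays i < N := by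
    intro i hi
    by_cases hib : i = b
    · subst hib
      exact hNb i₀ hi₀b _ (by rw [h.count_playing i hi]; exact hrR i₀ hi₀ hi₀b)
    · exact hNi i hib _ (by rw [h.count_playing i hi]; exact hrR i (h.playing_subset hi) hib)
  set playing' := s.playing.filter fun i => x i (s.plays i) = true with hplaying
  set plays' : ι → ℕ := fun i => if i ∈ s.playing then s.plays i + 1 else s.plays i with hplays
  set succ' : ι → ℕ := fun i => if i ∈ playing' then s.succ i + 1 else s.succ i with hsucc
  have hle' : ∀ i, plays' i ≤ N := by
    intro i
    simp only [hplays]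
    split_ifs with hi
    · exact hltN i hi
    · exact h.plays_le i
  have hsum : ∑ i, s.plays i < ∑ i, plays' i := by
    obtain ⟨j, hj⟩ := h.playing_nonempty
    refine Finset.sum_lt_sum (fun i _ => ?_) ⟨j, Finset.mem_univ _, ?_⟩
    · simp only [hplays]; split_ifs <;> omega
    · simp only [hplays, if_pos hj]; omega
  have hsub : playing' ⊆ s.playing := Finset.filter_subset _ _
  have htrue : ∀ i ∈ s.alive, Nat.count (fun t => x i t = true) (plays' i) = succ' i := by
    intro i hi
    have := h.count_true i hi
    by_cases hp : i ∈ s.playing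
    · simp only [hplays, hsucc, hplaying, Finset.mem_filter, hp, true_and, if_true, Nat.count_succ]
      split_ifs <;> omega
    · have hp' : i ∉ playing' := fun h' => hp (hsub h')
      simp only [hplays, hsucc, if_neg hp, if_neg hp', this]
  have hcp : ∀ i ∈ playing', Nat.count (fun t => x i t = false) (plays' i) = r := by
    intro i hi
    have hp := hsub hi
    have hx := (Finset.mem_filter.1 hi).2
    simp only [hplays, if_pos hp, Nat.count_succ, hx, h.count_playing i hp]
    simp
  have hcf : ∀ i ∈ s.alive, i ∉ playing' →
      Nat.count (fun t => x i t = false) (plays' i) = r + 1 ∧ EndsRound (x i) (plays' i) := by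
    intro i hi hn
    by_cases hp : i ∈ s.playing
    · have hx : x i (s.plays i) = false := by
        have : ¬ x i (s.plays i) = true := fun hx => hn (Finset.mem_filter.2 ⟨hp, hx⟩)
        simpa using this
      simp only [hplays, if_pos hp, Nat.count_succ, hx, h.count_playing i hp]
      refine ⟨by simp, fun t ht => ?_⟩
      obtain rfl : s.plays i = t := by omega
      exact hx
    · simp only [hplays, if_neg hp]
      exact h.count_failed i hi hp
  have hscore : ∀ i ∈ s.alive, i ∉ playing' → RoundScore (x i) (r + 1) (succ' i) :=
    fun i hi hn => ⟨plays' i, (hcf i hi hn).1, htrue i hi, (hcf i hi hn).2⟩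
  have hsucc_mono : s.succ b ≤ succ' b := by simp only [hsucc]; split_ifs <;> omega
  have hdead : ∀ i, i ∉ s.alive → succ' i < succ' b + k := by
    intro i hi
    have hp : i ∉ playing' := fun h' => hi (h.playing_subset (hsub h'))
    have := h.succ_lt i hi
    have : succ' i = s.succ i := by simp only [hsucc, if_neg hp]
    omega
  -- no arm gets `k` ahead of arm `b` once arm `b` has failed
  have hahead : b ∉ playing' → ∀ j ≠ b, succ' j < succ' b + k := by
    intro hb j hj
    by_cases hja : j ∈ s.alive
    · have hr := hrR j hja hj
      -- Since `r + 1 ≤ R j`, round `r + 1` of arm `j` is finite even if `j` is still playing, and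
      -- its final score `c` can be compared with that of `b`.
      obtain ⟨c, hc⟩ := (hC j hj).exists_of_le (Nat.succ_le_of_lt hr)
      have hlt := hlead j hj (r + 1) hr _ _ (hscore b h.mem_alive hb) hc
      by_cases hjp : j ∈ playing'
      · have := hc.count_le (p := plays' j) (by rw [hcp j hjp]; omega)
        rw [htrue j hja] at this
        omega
      · rwa [(hscore j hja hjp).unique hc]
    · exact hdead j hja
  have hstep : PlayTheWinner.step k x s =
      if ∃ j, playing' = {j} ∧ ∀ i, i ≠ j → succ' i + k ≤ succ' j then
        { alive := s.alive, playing := playing', plays := plays', succ := succ',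
          returned := sole playing' }
      else if playing' = ∅ then
        { alive := s.alive.filter fun i => ¬ ∃ j, j ≠ i ∧ succ' i + k ≤ succ' j,
          playing := s.alive.filter fun i => ¬ ∃ j, j ≠ i ∧ succ' i + k ≤ succ' j,
          plays := plays', succ := succ',
          returned := sole (s.alive.filter fun i => ¬ ∃ j, j ≠ i ∧ succ' i + k ≤ succ' j) }
      else
        { alive := s.alive, playing := playing', plays := plays', succ := succ',
          returned := none } := by
    unfold PlayTheWinner.step
    rw [if_neg (by simp [h.returned])]
  rw [hstep]
  clear_value plays' succ' playing'
  split_ifs with h1 h2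
  · -- early stop
    obtain ⟨j, hj, hjs⟩ := h1
    left
    have hjb : j = b := by
      by_contra hjb
      have hb : b ∉ playing' := by
        rw [hj, Finset.mem_singleton]; exact fun h' => hjb h'.symm
      have := hahead hb j hjb
      have := hjs b (Ne.symm hjb)
      omega
    subst hjb
    exact (sole_eq_some_iff _ _).2 hj
  · -- end of the round
    have hb : b ∉ playing' := by rw [h2]; simp
    have hempty : ∀ i, i ∉ playing' := by rw [h2]; simp
    set alive' := s.alive.filter fun i => ¬ ∃ j, j ≠ i ∧ succ' i + k ≤ succ' j with halive
    have hbal : b ∈ alive' := by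
      refine Finset.mem_filter.2 ⟨h.mem_alive, ?_⟩
      rintro ⟨j, hj, hle⟩
      have := hahead hb j hj
      omega
    by_cases hsole : alive' = {b}
    · exact Or.inl ((sole_eq_some_iff _ _).2 hsole)
    · refine Or.inr ⟨⟨r + 1, ?_⟩, hsum⟩
      refine ⟨?_, hbal, hsole, subset_rfl, ⟨b, hbal⟩, hle',
        fun i hi => htrue i (Finset.mem_filter.1 hi).1,
        fun i hi => (hcf i (Finset.mem_filter.1 hi).1 (hempty i)).1,
        fun i hi hn => absurd hi hn, ?_, ?_⟩
      · rcases ho : sole alive' with _ | j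
        · rfl
        · exfalso
          have hj := (sole_eq_some_iff _ _).1 ho
          have hbj := hbal
          rw [hj, Finset.mem_singleton] at hbj
          exact hsole (hbj ▸ hj)
      · intro i hi
        refine hahead hb i ?_
        rintro rfl
        exact hi hbal
      · intro i hi hib r' hr' a c ha hc
        obtain ⟨hia, hi⟩ := Finset.mem_filter.1 hi
        rcases Nat.lt_or_eq_of_le hr' with hlt | rfl
        · exact h.not_won i hia hib r' (by omega) a c ha hc
        -- A rival trailing `b` by `k` would just have been eliminated, with `b` as the witness.
        · rw [ha.unique (hscore b h.mem_alive hb), hc.unique (hscore i hia (hempty i))]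
          by_contra! hle
          exact hi ⟨b, Ne.symm hib, hle⟩
  · refine Or.inr ⟨⟨r, rfl, h.mem_alive, h.alive_ne, hsub.trans h.playing_subset,
      Finset.nonempty_iff_ne_empty.2 h2, hle', htrue, hcp, hcf, hdead, h.not_won⟩, hsum⟩

/-- If arm `b` beats all other arms, then the algorithm stops and returns `b`. -/
theorem returns_of_forall_beats [Nontrivial ι] {k : ℕ} (hk : 0 < k) {x : ι → ℕ → Bool} {b : ι}
    (h : ∀ i ≠ b, Beats k (x b) (x i)) : Returns k x b := by
  have h' := fun i hi => exists_of_beats hk (h i hi)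
  choose! R A C hA hC hwin hlead using h'
  choose! mb hmb using fun i hi => (hA i hi)
  choose! mi hmi using fun i hi => (hC i hi)
  let N := ∑ i, (mb i + mi i)
  have hN : ∀ i, mb i + mi i ≤ N := fun i =>
    Finset.single_le_sum (f := fun i => mb i + mi i) (fun _ _ => Nat.zero_le _) (Finset.mem_univ i)
  by_contra hret
  -- If `b` were never returned, the invariant would persist and every subround would add a play,
  -- against the bound `N` per arm.
  have key : ∀ t, (∃ r, RunInvariant k x b N r ((step k x)^[t] init)) ∧
      t ≤ ∑ i, ((step k x)^[t] init).plays i := by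
    intro t
    induction t with
    | zero => exact ⟨⟨0, RunInvariant.init hk x b N⟩, Nat.zero_le _⟩
    | succ t ih =>
      obtain ⟨⟨r, hr⟩, ht⟩ := ih
      rw [Function.iterate_succ_apply']
      rcases hr.step hA hC hwin hlead
        (fun i hi m hm => (lt_of_count_lt ((hmb i hi).1 ▸ hm)).trans_le
          ((Nat.le_add_right _ _).trans (hN i)))
        (fun i hi m hm => (lt_of_count_lt ((hmi i hi).1 ▸ hm)).trans_le
          ((Nat.le_add_left _ _).trans (hN i))) with hs | ⟨hinv, hlt⟩
      · exact absurd ⟨t + 1, by rw [Function.iterate_succ_apply']; exact hs⟩ hret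
      · exact ⟨hinv, by omega⟩
  obtain ⟨⟨r, hr⟩, ht⟩ := key (∑ _i : ι, N + 1)
  have := Finset.sum_le_sum fun i (_ : i ∈ Finset.univ) => hr.plays_le i
  omega

end RunWithWinner

/-! ### Measurability -/

theorem measurable_count (b : Bool) (m : ℕ) :
    Measurable fun x : ℕ → Bool => Nat.count (fun t => x t = b) m := by
  induction m with
  | zero => simp
  | succ m ih =>
    simp only [Nat.count_succ]
    refine ih.add (Measurable.ite ?_ measurable_const measurable_const)
    exact measurableSet_eq_fun (measurable_pi_apply m) measurable_const

theorem measurable_roundScore (r s : ℕ) : Measurable fun x : ℕ → Bool => RoundScore x r s := by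
  unfold RoundScore
  refine Measurable.exists fun m => Measurable.and ?_ (Measurable.and ?_ ?_)
  · exact measurableSet_setOfPred.1 (measurable_count false m (measurableSet_singleton r))
  · exact measurableSet_setOfPred.1 (measurable_count true m (measurableSet_singleton s))
  · refine Measurable.forall fun t => Measurable.imp measurable_const ?_
    exact measurableSet_setOfPred.1 (measurableSet_eq_fun (measurable_pi_apply t) measurable_const)

theorem measurable_beats (k : ℕ) :
    Measurable fun p : (ℕ → Bool) × (ℕ → Bool) => Beats k p.1 p.2 := by
  unfold Beats
  refine Measurable.exists fun r => Measurable.exists fun a => Measurable.exists fun b => ?_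
  refine ((measurable_roundScore r a).comp measurable_fst).and
    (((measurable_roundScore r b).comp measurable_snd).and (measurable_const.and ?_))
  refine Measurable.forall fun r' => Measurable.imp measurable_const ?_
  refine Measurable.forall fun a' => Measurable.forall fun b' => ?_
  exact ((measurable_roundScore r' a').comp measurable_fst).imp
    (((measurable_roundScore r' b').comp measurable_snd).imp measurable_const)

/-- The pairs of arms of which the first one beats the second one. -/
def beatsSet (k : ℕ) : Set ((unitInterval × (ℕ → Bool)) × (unitInterval × (ℕ → Bool))) :=
  {p | Beats k p.1.2 p.2.2}

theorem measurableSet_beatsSet (k : ℕ) : MeasurableSet (beatsSet k) :=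
  measurableSet_setOfPred.2 ((measurable_beats k).comp
    ((measurable_snd.comp measurable_fst).prodMk (measurable_snd.comp measurable_snd)))

/-- The data in the order of the numbering. -/
def renumber {n : ℕ} (ω : Data n × Equiv.Perm (Fin n)) : Data n := fun i => ω.1 (ω.2 i)

theorem measurable_renumber {n : ℕ} : Measurable (renumber (n := n)) :=
  measurable_from_prod_countable_left fun σ => measurable_pi_lambda _ fun i =>
    measurable_pi_apply (σ i)

/-! ### The largest mean -/

/-- The arms with the largest mean. -/
def maxArms {n : ℕ} (d : Data n) : Finset (Fin n) :=
  Finset.univ.filter fun j => ∀ i, (d i).1 ≤ (d j).1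

theorem mem_maxArms {n : ℕ} {d : Data n} {j : Fin n} :
    j ∈ maxArms d ↔ ∀ i, (d i).1 ≤ (d j).1 := by
  simp [maxArms]

theorem mem_bestFirst {n : ℕ} [NeZero n] {d : Data n} {σ : Equiv.Perm (Fin n)} :
    σ ∈ bestFirst d ↔ σ 0 ∈ maxArms d := mem_maxArms.symm

theorem mem_maxArms_comp {n : ℕ} {d : Data n} {σ : Equiv.Perm (Fin n)} {j : Fin n} :
    j ∈ maxArms (fun i => d (σ i)) ↔ σ j ∈ maxArms d := by
  simp only [mem_maxArms]
  exact σ.forall_congr_left (p := fun i => (d (σ i)).1 ≤ (d (σ j)).1) |>.trans (by simp)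

theorem card_maxArms_comp {n : ℕ} (d : Data n) (σ : Equiv.Perm (Fin n)) :
    (maxArms (fun i => d (σ i))).card = (maxArms d).card :=
  Finset.card_equiv σ fun _ => mem_maxArms_comp

/-- The number of permutations that fix `0`. -/
def fixZeroCard (n : ℕ) [NeZero n] : ℕ :=
  (Finset.univ.filter fun σ : Equiv.Perm (Fin n) => σ 0 = 0).card

/-- Composing with the transposition of `0` and `b` maps the permutations sending `0` to `b` onto
the stabilizer of `0`. -/
theorem card_filter_apply_zero_mem {n : ℕ} [NeZero n] (M : Finset (Fin n)) :
    (Finset.univ.filter fun σ : Equiv.Perm (Fin n) => σ 0 ∈ M).card = M.card * fixZeroCard n := by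
  rw [Finset.card_eq_sum_card_fiberwise (f := fun σ : Equiv.Perm (Fin n) => σ 0) (t := M)
    (fun σ hσ => by simpa using hσ), Finset.sum_const_nat]
  intro b hb
  refine Finset.card_equiv (Equiv.mulLeft (Equiv.swap 0 b)) fun σ => ?_
  simp only [Finset.mem_filter, Finset.mem_univ, true_and, Equiv.coe_mulLeft, Equiv.Perm.mul_apply]
  constructor
  · rintro ⟨-, h⟩
    simp [h]
  · intro h
    have : σ 0 = b := by
      have := congrArg (Equiv.swap 0 b) h
      simpa using this
    exact ⟨this ▸ hb, this⟩

/-- The number of best arms is invariant under renumbering, so each summand depends on the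
renumbered data alone. Exchangeability will then make all summands integrate to the same value. -/
theorem uniformOn_bestFirst_apply {n : ℕ} [NeZero n] (d : Data n) (A : Set (Data n)) :
    uniformOn (bestFirst d) {σ | (fun i => d (σ i)) ∈ A} =
      ∑ σ : Equiv.Perm (Fin n), A.indicator (fun e => if 0 ∈ maxArms e then
        (fixZeroCard n : ENNReal)⁻¹ * ((maxArms e).card : ENNReal)⁻¹ else 0) (fun i => d (σ i)) := by
  classical
  let s : Finset (Equiv.Perm (Fin n)) := Finset.univ.filter fun σ => σ 0 ∈ maxArms d
  let t : Finset (Equiv.Perm (Fin n)) := Finset.univ.filter fun σ => (fun i => d (σ i)) ∈ A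
  have hs : bestFirst d = (s : Set (Equiv.Perm (Fin n))) := by
    ext σ; simp [s, mem_bestFirst]
  have ht : {σ : Equiv.Perm (Fin n) | (fun i => d (σ i)) ∈ A} = (t : Set _) := by
    ext σ; simp [t]
  rw [hs, ht, uniformOn_apply_finset]
  have hcard : (s.card : ENNReal)⁻¹ =
      (fixZeroCard n : ENNReal)⁻¹ * ((maxArms d).card : ENNReal)⁻¹ := by
    rw [card_filter_apply_zero_mem, Nat.cast_mul, mul_comm, ENNReal.mul_inv] <;> simp
  have hterm : ∀ σ : Equiv.Perm (Fin n), A.indicator (fun e => if 0 ∈ maxArms e then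
      (fixZeroCard n : ENNReal)⁻¹ * ((maxArms e).card : ENNReal)⁻¹ else 0) (fun i => d (σ i)) =
      if σ ∈ s ∩ t then (s.card : ENNReal)⁻¹ else 0 := by
    intro σ
    rw [Set.indicator_apply]
    simp only [card_maxArms_comp, mem_maxArms_comp, ← hcard, s, t, Finset.mem_inter,
      Finset.mem_filter, Finset.mem_univ, true_and]
    split_ifs <;> simp_all
  rw [Finset.sum_congr rfl fun σ _ => hterm σ, Finset.sum_ite_mem, Finset.univ_inter,
    Finset.sum_const, nsmul_eq_mul, div_eq_mul_inv]

/-! ### Breaking ties with a uniform variable -/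

/-- The probability that an arm with mean `q` loses the comparison of means with an arm of mean `p`
when ties are broken by independent uniform variables, that of the latter arm being `u`. -/
def tieWeight (u p q : unitInterval) : ENNReal :=
  if q < p then 1 else if q = p then ENNReal.ofReal u else 0

theorem lintegral_unitInterval_pow (j : ℕ) :
    ∫⁻ u : unitInterval, ENNReal.ofReal u ^ j = ((j + 1 : ℕ) : ENNReal)⁻¹ := by
  have h := unitInterval.measurePreserving_coe.lintegral_comp
    (f := fun x : ℝ => ENNReal.ofReal x ^ j) (by fun_prop)
  rw [h]
  have h2 : ∫⁻ x in unitInterval, ENNReal.ofReal x ^ j =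
      ∫⁻ x in unitInterval, ENNReal.ofReal (x ^ j) :=
    setLIntegral_congr_fun measurableSet_Icc fun x hx => (ENNReal.ofReal_pow hx.1 j).symm
  rw [h2, ← ofReal_integral_eq_lintegral_ofReal]
  · rw [unitInterval, integral_Icc_eq_integral_Ioc, ← intervalIntegral.integral_of_le zero_le_one,
      integral_pow]
    rw [← ENNReal.ofReal_natCast, ← ENNReal.ofReal_inv_of_pos (by positivity)]
    congr 1
    simp
  · exact (continuous_pow j).continuousOn.integrableOn_compact isCompact_Icc
  · exact (ae_restrict_iff' measurableSet_Icc).2 (ae_of_all _ fun x hx => pow_nonneg hx.1 j)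

/-- The factor `1 / card` couples all arms. If `j` other arms tie with a best arm `0`, it equals `∫
u^j du = 1 / (j + 1)`, a mixture over `u` of products with one factor per arm. -/
theorem lintegral_prod_tieWeight {m : ℕ} (e : Data (m + 1)) :
    ∫⁻ u : unitInterval, ∏ i : Fin m, tieWeight u (e 0).1 (e i.succ).1 =
      if 0 ∈ maxArms e then ((maxArms e).card : ENNReal)⁻¹ else 0 := by
  classical
  split_ifs with h
  · have hmax := mem_maxArms.1 h
    have hprod : ∀ u : unitInterval, ∏ i : Fin m, tieWeight u (e 0).1 (e i.succ).1 =
        ENNReal.ofReal u ^ (Finset.univ.filter fun i : Fin m => (e i.succ).1 = (e 0).1).card := by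
      intro u
      rw [← Finset.prod_const, Finset.prod_filter]
      refine Finset.prod_congr rfl fun i _ => ?_
      rcases (hmax i.succ).lt_or_eq with hlt | heq
      · simp [tieWeight, hlt, hlt.ne]
      · simp [tieWeight, heq]
    simp_rw [hprod]
    rw [lintegral_unitInterval_pow]
    congr 2
    have hM : maxArms e = Finset.univ.filter fun i => (e i).1 = (e 0).1 := by
      ext j
      simp only [mem_maxArms, Finset.mem_filter, Finset.mem_univ, true_and]
      exact ⟨fun hj => le_antisymm (hmax j) (hj 0), fun hj i => hj ▸ hmax i⟩
    rw [hM, Fin.card_filter_univ_succ, if_pos rfl]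
  · have : ∃ i : Fin (m + 1), (e 0).1 < (e i).1 := by
      by_contra! hall
      exact h (mem_maxArms.2 hall)
    obtain ⟨i, hi⟩ := this
    obtain ⟨j, rfl⟩ : ∃ j : Fin m, i = j.succ := by
      obtain ⟨j, hj⟩ := Fin.exists_succ_eq.2 fun h0 : i = 0 => lt_irrefl _ (h0 ▸ hi)
      exact ⟨j, hj.symm⟩
    have hz : ∀ u : unitInterval, ∏ i : Fin m, tieWeight u (e 0).1 (e i.succ).1 = 0 := fun u =>
      Finset.prod_eq_zero (Finset.mem_univ j) (by simp [tieWeight, hi.not_gt, hi.ne'])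
    simp only [hz, lintegral_zero]

theorem measurable_tieWeight {X : Type*} [MeasurableSpace X] {f g h : X → unitInterval}
    (hf : Measurable f) (hg : Measurable g) (hh : Measurable h) :
    Measurable fun x => tieWeight (f x) (g x) (h x) := by
  unfold tieWeight
  refine Measurable.ite (measurableSet_lt hh hg) measurable_const
    (Measurable.ite (measurableSet_eq_fun hh hg) ?_ measurable_const)
  exact (measurable_subtype_coe.comp hf).ennreal_ofReal

/-! ### Integration over the arms -/

/-- Permuting i.i.d. coordinates preserves the law. -/
theorem measurePreserving_dataMeasure_perm (F : Measure unitInterval) [IsProbabilityMeasure F]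
    {n : ℕ} (σ : Equiv.Perm (Fin n)) :
    MeasurePreserving (fun (d : Data n) i => d (σ i)) (dataMeasure F n) (dataMeasure F n) := by
  have h := measurePreserving_piCongrLeft
    (fun _ : Fin n => F ⊗ₘ rewardKernel) σ.symm
  have he : (⇑(MeasurableEquiv.piCongrLeft (fun _ : Fin n => unitInterval × (ℕ → Bool)) σ.symm)) =
      fun (d : Data n) i => d (σ i) := by
    funext d i
    rw [MeasurableEquiv.coe_piCongrLeft]
    have := Equiv.piCongrLeft_apply_apply
      (P := fun _ : Fin n => unitInterval × (ℕ → Bool)) σ.symm d (σ i)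
    simpa using this
  rw [he] at h
  exact h

/-- Tonelli's theorem for a product over the coordinates. -/
theorem lintegral_pi_prod_eq_prod {X : Type*} [MeasurableSpace X] (μ : Measure X)
    [IsProbabilityMeasure μ] {m : ℕ} {g : Fin m → X → ENNReal} (hg : ∀ i, Measurable (g i)) :
    ∫⁻ x, ∏ i, g i (x i) ∂(Measure.pi fun _ : Fin m => μ) = ∏ i, ∫⁻ a, g i a ∂μ := by
  have hind := iIndepFun_pi (μ := fun _ : Fin m => μ) (X := g) fun i => (hg i).aemeasurable
  rw [lintegral_prod_eq_prod_lintegral_of_indepFun Finset.univ _ hind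
    fun i => (hg i).comp (measurable_pi_apply i)]
  refine Finset.prod_congr rfl fun i _ => ?_
  exact (measurePreserving_eval (fun _ : Fin m => μ) i).lintegral_comp (hg i)

/-- Given coordinate `0`, the other coordinates are independent. -/
theorem lintegral_pi_succ {X : Type*} [MeasurableSpace X] (μ : Measure X)
    [IsProbabilityMeasure μ] {m : ℕ} {g : Fin m → X × X → ENNReal} (hg : ∀ i, Measurable (g i)) :
    ∫⁻ x, ∏ i : Fin m, g i (x 0, x i.succ) ∂(Measure.pi fun _ : Fin (m + 1) => μ) =
      ∫⁻ a, ∏ i, ∫⁻ a', g i (a, a') ∂μ ∂μ := by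
  have h := (measurePreserving_piFinSuccAbove (fun _ : Fin (m + 1) => μ) 0).symm
  have hm : Measurable fun x : Fin (m + 1) → X => ∏ i : Fin m, g i (x 0, x i.succ) :=
    Finset.measurable_prod _ fun i _ => (hg i).comp (by fun_prop)
  rw [← h.lintegral_comp hm]
  refine (lintegral_prod _ (hm.comp (MeasurableEquiv.measurable _)).aemeasurable).trans ?_
  refine lintegral_congr fun a => ?_
  rw [← lintegral_pi_prod_eq_prod μ (g := fun i a' => g i (a, a'))
    fun i => (hg i).comp measurable_prodMk_left]
  refine lintegral_congr fun y => ?_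
  simp [MeasurableEquiv.piFinSuccAbove_symm_apply, Fin.insertNthEquiv]

/-- The probability, for another arm, of a smaller mean (ties being broken at random) and a
relation `S` of its data to those of an arm with data `z.2` and tie-breaking variable `z.1`. -/
def relProb (F : Measure unitInterval)
    (S : Set ((unitInterval × (ℕ → Bool)) × (unitInterval × (ℕ → Bool))))
    (z : unitInterval × (unitInterval × (ℕ → Bool))) : ENNReal :=
  ∫⁻ a, S.indicator (fun _ => 1) (z.2, a) * tieWeight z.1 z.2.1 a.1 ∂(F ⊗ₘ rewardKernel)

theorem measurable_relProb (F : Measure unitInterval) [IsProbabilityMeasure F]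
    {S : Set ((unitInterval × (ℕ → Bool)) × (unitInterval × (ℕ → Bool)))} (hS : MeasurableSet S) :
    Measurable (relProb F S) := by
  refine Measurable.lintegral_prod_right' (f := fun y : (unitInterval × (unitInterval ×
    (ℕ → Bool))) × (unitInterval × (ℕ → Bool)) => S.indicator (fun _ => 1) (y.1.2, y.2) *
      tieWeight y.1.1 y.1.2.1 y.2.1) ?_
  refine Measurable.mul ?_ (measurable_tieWeight (by fun_prop) (by fun_prop) (by fun_prop))
  exact (measurable_const.indicator hS).comp (by fun_prop)

/-- The data in which arm `0` is in relation `S i` to arm `i + 1`. -/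
def relEvent {m : ℕ}
    (S : Fin m → Set ((unitInterval × (ℕ → Bool)) × (unitInterval × (ℕ → Bool)))) :
    Set (Data (m + 1)) := {e | ∀ i, (e 0, e i.succ) ∈ S i}

theorem measurableSet_relEvent {m : ℕ}
    {S : Fin m → Set ((unitInterval × (ℕ → Bool)) × (unitInterval × (ℕ → Bool)))}
    (hS : ∀ i, MeasurableSet (S i)) : MeasurableSet (relEvent S) := by
  rw [relEvent, Set.ofPred_forall]
  exact MeasurableSet.iInter fun i => (hS i).preimage (by fun_prop)

/-- Averaging over numberings gives equal terms by exchangeability. Once the tie-breaking variable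
and the data of arm `0` are fixed, the integrand is a product over the other arms. -/
theorem banditMeasure_relEvent (F : Measure unitInterval) [IsProbabilityMeasure F] {m : ℕ}
    {S : Fin m → Set ((unitInterval × (ℕ → Bool)) × (unitInterval × (ℕ → Bool)))}
    (hS : ∀ i, MeasurableSet (S i)) :
    banditMeasure F (m + 1) (renumber ⁻¹' relEvent S) =
      (Fintype.card (Equiv.Perm (Fin (m + 1))) * (fixZeroCard (m + 1) : ENNReal)⁻¹) *
        ∫⁻ z, ∏ i, relProb F (S i) z ∂((volume : Measure unitInterval).prod
          (F ⊗ₘ rewardKernel)) := by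
  classical
  set K : ENNReal := (fixZeroCard (m + 1) : ENNReal)⁻¹
  have hA := measurableSet_relEvent hS
  let G : Data (m + 1) → unitInterval → ENNReal := fun e u =>
    ∏ i : Fin m, ((S i).indicator (fun _ => 1) (e 0, e i.succ) * tieWeight u (e 0).1 (e i.succ).1)
  have hGm : Measurable (Function.uncurry G) := by
    refine Finset.measurable_prod _ fun i _ => Measurable.mul ?_
      (measurable_tieWeight (by fun_prop) (by fun_prop) (by fun_prop))
    exact (measurable_const.indicator (hS i)).comp (by fun_prop)
  have hGm' : Measurable fun e => ∫⁻ u, G e u := hGm.lintegral_prod_right'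
  have hW : ∀ e : Data (m + 1), (relEvent S).indicator (fun e => if 0 ∈ maxArms e then
      K * ((maxArms e).card : ENNReal)⁻¹ else 0) e = K * ∫⁻ u, G e u := by
    intro e
    simp only [G, Finset.prod_mul_distrib]
    rw [Set.indicator_apply]
    split_ifs with he h0
    · have : ∀ i, (S i).indicator (fun _ => (1 : ENNReal)) (e 0, e i.succ) = 1 := fun i =>
        Set.indicator_of_mem (he i) _
      simp only [this, Finset.prod_const_one, one_mul, lintegral_prod_tieWeight, if_pos h0]
    · have : ∀ i, (S i).indicator (fun _ => (1 : ENNReal)) (e 0, e i.succ) = 1 := fun i =>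
        Set.indicator_of_mem (he i) _
      simp only [this, Finset.prod_const_one, one_mul, lintegral_prod_tieWeight, if_neg h0,
        mul_zero]
    · obtain ⟨i, hi⟩ := not_forall.1 he
      have : ∏ i, (S i).indicator (fun _ => (1 : ENNReal)) (e 0, e i.succ) = 0 :=
        Finset.prod_eq_zero (Finset.mem_univ i) (Set.indicator_of_notMem hi _)
      simp [this]
  have hint : ∫⁻ e, (∫⁻ u, G e u) ∂(dataMeasure F (m + 1)) =
      ∫⁻ z, ∏ i, relProb F (S i) z ∂((volume : Measure unitInterval).prod
          (F ⊗ₘ rewardKernel)) := by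
    rw [lintegral_lintegral_swap hGm.aemeasurable, lintegral_prod]
    · refine lintegral_congr fun u => ?_
      refine lintegral_pi_succ (F ⊗ₘ rewardKernel) (g := fun i p => (S i).indicator (fun _ => 1) p *
        tieWeight u p.1.1 p.2.1) fun i => ?_
      exact (measurable_const.indicator (hS i)).mul
        (measurable_tieWeight (by fun_prop) (by fun_prop) (by fun_prop))
    · exact (Finset.measurable_prod _ fun i _ => measurable_relProb F (hS i)).aemeasurable
  rw [← hint, banditMeasure, Measure.compProd_apply (measurable_renumber hA)]
  have hker : ∀ d : Data (m + 1), numberingKernel (m + 1) d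
      (Prod.mk d ⁻¹' (renumber ⁻¹' relEvent S)) =
      ∑ σ : Equiv.Perm (Fin (m + 1)), K * ∫⁻ u, G (fun i => d (σ i)) u := by
    intro d
    simp_rw [← hW]
    exact uniformOn_bestFirst_apply d (relEvent S)
  simp_rw [hker]
  rw [lintegral_finsetSum]
  · have hσ : ∀ σ : Equiv.Perm (Fin (m + 1)),
        ∫⁻ d, K * (∫⁻ u, G (fun i => d (σ i)) u) ∂(dataMeasure F (m + 1)) =
          K * ∫⁻ e, (∫⁻ u, G e u) ∂(dataMeasure F (m + 1)) := by
      intro σ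
      rw [(measurePreserving_dataMeasure_perm F σ).lintegral_comp
        (f := fun e => K * ∫⁻ u, G e u) (hGm'.const_mul K), lintegral_const_mul _ hGm']
    simp only [hσ, Finset.sum_const, nsmul_eq_mul, Finset.card_univ, mul_assoc]
  · intro σ _
    exact (hGm'.comp (measurePreserving_dataMeasure_perm F σ).measurable).const_mul K

/-- Hölder's inequality in the form in which it compares the probabilities. -/
theorem lintegral_mul_pow_pow_le {X : Type*} [MeasurableSpace X] {μ : Measure X}
    {f g : X → ENNReal} (hf : Measurable f) (hg : Measurable g) (m : ℕ)
    (h1 : ∫⁻ x, g x ^ (m + 1) ∂μ = 1) :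
    (∫⁻ x, f x * g x ^ m ∂μ) ^ (m + 1) ≤ ∫⁻ x, f x ^ (m + 1) ∂μ := by
  have hm : ((m + 1 : ℕ) : ℝ) ≠ 0 := by positivity
  -- Exponents `1/(m+1)` and `m/(m+1)`, applied to `f^(m+1)` and `g^(m+1)`; the second integral is
  -- one.
  have h := ENNReal.lintegral_mul_norm_pow_le (μ := μ) (hf.pow_const (m + 1)).aemeasurable
    (hg.pow_const (m + 1)).aemeasurable (p := ((m + 1 : ℕ) : ℝ)⁻¹) (q := m * ((m + 1 : ℕ) : ℝ)⁻¹)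
    (by positivity) (by positivity) (by field_simp; push_cast; ring)
  have e1 : ∀ y : ENNReal, (y ^ (m + 1)) ^ ((m + 1 : ℕ) : ℝ)⁻¹ = y := fun y => by
    rw [← ENNReal.rpow_natCast, ← ENNReal.rpow_mul, mul_inv_cancel₀ hm, ENNReal.rpow_one]
  have e2 : ∀ y : ENNReal, (y ^ (m + 1)) ^ (m * ((m + 1 : ℕ) : ℝ)⁻¹) = y ^ m := fun y => by
    rw [mul_comm, ENNReal.rpow_mul, e1, ENNReal.rpow_natCast]
  simp only [e1, e2, h1, ENNReal.one_rpow, mul_one] at h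
  calc (∫⁻ x, f x * g x ^ m ∂μ) ^ (m + 1)
      ≤ ((∫⁻ x, f x ^ (m + 1) ∂μ) ^ ((m + 1 : ℕ) : ℝ)⁻¹) ^ (m + 1) := by gcongr
    _ = _ := by
      rw [← ENNReal.rpow_natCast, ← ENNReal.rpow_mul, inv_mul_cancel₀ hm, ENNReal.rpow_one]

/-! ### The three inequalities between the probabilities -/

theorem eventB_eq (k m : ℕ) :
    eventB k (m + 1) = renumber ⁻¹' relEvent fun _ => beatsSet k := by
  ext ω
  simp only [eventB, Set.mem_iInter, eventBi, Set.mem_ofPred_eq, Set.mem_preimage, relEvent,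
    beatsSet, renumber, Fin.forall_fin_succ]
  simp [Fin.succ_ne_zero]

theorem eventBi_eq (k m : ℕ) (j : Fin m) :
    eventBi k (m + 1) j.succ =
      renumber ⁻¹' relEvent fun i => if i = j then beatsSet k else Set.univ := by
  ext ω
  simp only [eventBi, Set.mem_ofPred_eq, Set.mem_preimage, relEvent, renumber]
  constructor
  · intro h i
    split_ifs with hi
    · exact hi ▸ h
    · trivial
  · intro h
    have := h j
    rwa [if_pos rfl] at this

theorem banditMeasure_eventBi_pow_le (F : Measure unitInterval) [IsProbabilityMeasure F]
    (k m : ℕ) (j : Fin (m + 1)) :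
    banditMeasure F (m + 2) (eventBi k (m + 2) j.succ) ^ (m + 1) ≤
      banditMeasure F (m + 2) (eventB k (m + 2)) := by
  classical
  have hb := measurableSet_beatsSet k
  have hu : MeasurableSet (Set.univ : Set ((unitInterval × (ℕ → Bool)) ×
    (unitInterval × (ℕ → Bool)))) := MeasurableSet.univ
  set c : ENNReal := Fintype.card (Equiv.Perm (Fin (m + 2))) * (fixZeroCard (m + 2) : ENNReal)⁻¹
    with hc
  set ρ := (volume : Measure unitInterval).prod (F ⊗ₘ rewardKernel)
  -- The trivial relation describes the sure event. This normalizes `g` under `c • ρ` without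
  -- evaluating `c`.
  have hone : ∫⁻ z, relProb F Set.univ z ^ (m + 1) ∂(c • ρ) = 1 := by
    have h := banditMeasure_relEvent F (m := m + 1) (S := fun _ => Set.univ) fun _ => hu
    have huniv : renumber ⁻¹' relEvent (m := m + 1) (fun _ => Set.univ) = Set.univ :=
      Set.eq_univ_of_forall fun ω i => Set.mem_univ _
    rw [huniv, measure_univ] at h
    rw [lintegral_smul_measure, smul_eq_mul, h]
    simp [ρ, c]
  rw [eventB_eq, eventBi_eq, banditMeasure_relEvent F fun _ => hb,
    banditMeasure_relEvent F fun i => by split_ifs <;> assumption, ← hc]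
  -- For `B_i` only one rival has to lose the game; the other `m` only have to lose the comparison
  -- of means.
  have hprod : ∀ z, ∏ i : Fin (m + 1), relProb F (if i = j then beatsSet k else Set.univ) z =
      relProb F (beatsSet k) z * relProb F Set.univ z ^ m := by
    intro z
    rw [← Finset.mul_prod_erase Finset.univ _ (Finset.mem_univ j), if_pos rfl]
    congr 1
    rw [Finset.prod_congr rfl fun i hi => by rw [if_neg (Finset.ne_of_mem_erase hi)]]
    simp
  simp only [hprod, Finset.prod_const, Finset.card_univ, Fintype.card_fin]
  have := lintegral_mul_pow_pow_le (measurable_relProb F hb) (measurable_relProb F hu) m hone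
  simpa only [lintegral_smul_measure, smul_eq_mul] using this

theorem eventB_subset_eventBstar (k n : ℕ) [NeZero n] : eventB k n ⊆ eventBstar k n :=
  fun _ h i hi _ => Set.mem_iInter₂.1 h i hi

/-- Almost surely, number `0` is an arm with the largest mean. -/
theorem ae_mem_bestFirst (F : Measure unitInterval) [IsProbabilityMeasure F] (n : ℕ) [NeZero n] :
    ∀ᵐ ω ∂(banditMeasure F n), ω.2 ∈ bestFirst ω.1 := by
  have hmeas : MeasurableSet {ω : Data n × Equiv.Perm (Fin n) | ω.2 ∈ bestFirst ω.1} := by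
    have : {ω : Data n × Equiv.Perm (Fin n) | ω.2 ∈ bestFirst ω.1} =
        renumber ⁻¹' ⋂ i, {e | (e i).1 ≤ (e 0).1} := by
      ext ω
      simp only [Set.mem_ofPred_eq, Set.mem_preimage, Set.mem_iInter, renumber, bestFirst]
      exact ⟨fun h i => h _, fun h i => by simpa using h (ω.2.symm i)⟩
    rw [this]
    exact measurable_renumber
      (MeasurableSet.iInter fun i => measurableSet_le (by fun_prop) (by fun_prop))
  refine Measure.ae_compProd_of_ae_ae hmeas (ae_of_all _ fun d => ?_)
  rw [ae_iff]
  refine (uniformOn_eq_zero_iff (Set.toFinite _)).2 ?_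
  ext σ
  simp

/-- The inclusion holds only where number `0` is a best arm, hence almost surely. Monotonicity of
the outer measure suffices, so `eventC` need not be shown measurable. -/
theorem banditMeasure_eventB_le_eventC (F : Measure unitInterval) [IsProbabilityMeasure F]
    {n : ℕ} [NeZero n] (hn : 2 ≤ n) {k : ℕ} (hk : 0 < k) :
    banditMeasure F n (eventB k n) ≤ banditMeasure F n (eventC k n) := by
  have : Nontrivial (Fin n) := Fin.nontrivial_iff_two_le.2 hn
  refine measure_mono_ae ?_
  filter_upwards [ae_mem_bestFirst F n] with ω hω hB
  refine ⟨ω.2 0, returns_of_forall_beats hk fun i hi => ?_, hω⟩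
  have h := Set.mem_iInter₂.1 hB (ω.2.symm i) fun h0 => hi (by simp [← h0])
  simpa [eventBi] using h

end PlayTheWinner

end

theorem mainTheorem8 (n : ℕ) [NeZero n] (hn : 2 ≤ n) (k : ℕ) (hk : 0 < k)
    (F : Measure unitInterval) [IsProbabilityMeasure F] :
    PlayTheWinner.banditMeasure F n (PlayTheWinner.eventC k n) ≥
        PlayTheWinner.banditMeasure F n (PlayTheWinner.eventB k n) ∧
      PlayTheWinner.banditMeasure F n (PlayTheWinner.eventB k n) ≥
        PlayTheWinner.banditMeasure F n (PlayTheWinner.eventBi k n ⟨1, hn⟩) ^ (n - 1) ∧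
      PlayTheWinner.banditMeasure F n (PlayTheWinner.eventB k n) ≤
        PlayTheWinner.banditMeasure F n (PlayTheWinner.eventBstar k n) := by
  refine ⟨PlayTheWinner.banditMeasure_eventB_le_eventC F hn hk, ?_,
    measure_mono (PlayTheWinner.eventB_subset_eventBstar k n)⟩
  obtain ⟨m, rfl⟩ : ∃ m, n = m + 2 := ⟨n - 2, by omega⟩
  -- With `n = m + 2`, number `1` is the successor of `0 : Fin (m + 1)`, and `n - 1` reduces to `m +
  -- 1`.
  exact PlayTheWinner.banditMeasure_eventBi_pow_le F k m 0
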